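/- Let $d\ge 3$, let $\omega=e^{2\pi i/d}$, and consider in $\mathbb C^d\otimes\mathbb C^d\otimes\mathbb C^d$ (parties $A,B,C$) the following $d+3$ unnormalized pure states, where $l\oplus 1$ denotes $l+1$ modulo $d$: $$\sum_{l=0}^{d-1}\omega^{jl}|l,l,l\rangle\quad(j=0,1,\dots,d-1),\qquad \sum_{l=0}^{d-1}|l\oplus 1,l,l\rangle,\qquad \sum_{l=0}^{d-1}|l,l\oplus 1,l\rangle,\qquad \sum_{l=0}^{d-1}|l,l,l\oplus 1\rangle .$$ Each of these states is maximally entangled across each of the bipartitions $A|BC$, $B|AC$, $C|AB$ (that is, the reduced state of the party with the smaller dimension is maximally mixed), and the set of these $d+3$ states is strongly nonlocal. Here a set of nonzero, pairwise orthogonal pure states of a system of $n\ge 3$ parties is called strongly nonlocal if for no division of the parties into two nonempty groups, each of which may act jointly, the states can be perfectly distinguished by local operations and classical communication (LOCC) between the two groups. Perfectly distinguished means that some LOCC protocol, which may use ancillas and arbitrarily many rounds of local measurements with communicated outcomes, identifies each state of the set with probability one. -/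

import Mathlib

open scoped Matrix

/-!  Two-party LOCC.  A pure state `∑ M x y |x⟩|y⟩` of a bipartite system is represented by its
coefficient matrix `M`; a local operator `K` of the first party then acts as `K * M`, a local
operator `L` of the second party as `M * Lᵀ`. States need not be normalized. -/

/-- What is done next in an LOCC protocol that has to identify a label in `ι`, when the first party
currently holds an `a`-dimensional and the second party a `b`-dimensional system (ancillas
included). Either the protocol stops and announces a label, or one of the parties performs a local
measurement with Kraus operators `K k` (the dimension of the system of that party may change, in
dependence on the outcome) and communicates the outcome `k`, and the protocol goes on from
the control state `next k`. Here `Ctrl a b` is the set of control states of the protocol in which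
the parties hold systems of dimensions `a` and `b`; it serves as the classical memory. -/
inductive LOCCStep (ι : Type) (Ctrl : ℕ → ℕ → Type) (a b : ℕ) : Type
  | announce (i : ι) : LOCCStep ι Ctrl a b
  | measureFst (r : ℕ) (a' : Fin r → ℕ)
      (K : (k : Fin r) → Matrix (Fin (a' k)) (Fin a) ℂ)
      (complete : ∑ k, (K k)ᴴ * K k = 1)
      (next : (k : Fin r) → Ctrl (a' k) b) : LOCCStep ι Ctrl a b
  | measureSnd (r : ℕ) (b' : Fin r → ℕ)
      (L : (k : Fin r) → Matrix (Fin (b' k)) (Fin b) ℂ)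
      (complete : ∑ k, (L k)ᴴ * L k = 1)
      (next : (k : Fin r) → Ctrl a (b' k)) : LOCCStep ι Ctrl a b

/-- A two-party LOCC protocol on `ℂ^a ⊗ ℂ^b` whose purpose is to identify a label in `ι`. Since the
set of control states may be infinite, the number of rounds can be finite or unbounded. -/
structure LOCCProtocol (ι : Type) (a b : ℕ) where
  /-- the control states -/
  Ctrl : ℕ → ℕ → Type
  /-- the action taken in a control state -/
  step : {a b : ℕ} → Ctrl a b → LOCCStep ι Ctrl a b
  /-- the initial control state -/
  start : Ctrl a b

/-- The squared norm of a bipartite pure state. -/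
noncomputable def stateNormSq {α β : Type} [Fintype α] [Fintype β] (M : Matrix α β ℂ) : ℝ :=
  ∑ x, ∑ y, ‖M x y‖ ^ 2

/-- The probability (times the squared norm of the state `M`) that, run from the control state `s`
on the state `M`, a protocol with step function `step` announces the label `i` after fewer than
`n` measurements. After outcome `k` of a measurement the unnormalized state is
`(K k ⊗ 1) M`, whose squared norm accounts for the probability of that outcome. -/
noncomputable def announceWithin {ι : Type} [DecidableEq ι] {Ctrl : ℕ → ℕ → Type}
    (step : {a b : ℕ} → Ctrl a b → LOCCStep ι Ctrl a b) (i : ι) :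
    (n : ℕ) → {a b : ℕ} → (s : Ctrl a b) → (M : Matrix (Fin a) (Fin b) ℂ) → ℝ
  | 0, _, _, _, _ => 0
  | n + 1, _, _, s, M =>
    match step s with
    | .announce j => if j = i then stateNormSq M else 0
    | .measureFst _ _ K _ next => ∑ k, announceWithin step i n (next k) (K k * M)
    | .measureSnd _ _ L _ next => ∑ k, announceWithin step i n (next k) (M * (L k)ᵀ)

/-- A family of (not necessarily normalized) pure states of a bipartite system with computational
bases `α` and `β` is perfectly distinguishable by LOCC if some LOCC protocol announces `i`
with probability one whenever the state is the `i`-th one. (The basis vectors are numbered in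
order to apply a protocol on `ℂ^a ⊗ ℂ^b`; how this is done is immaterial.) -/
def LOCCDistinguishable {ι α β : Type} [DecidableEq ι] [Fintype α] [Fintype β]
    (M : ι → Matrix α β ℂ) : Prop :=
  ∃ (a b : ℕ) (eA : α ≃ Fin a) (eB : β ≃ Fin b) (P : LOCCProtocol ι a b), ∀ i,
    Filter.Tendsto
      (fun n => announceWithin P.step i n P.start (Matrix.reindex eA eB (M i)))
      Filter.atTop (nhds (stateNormSq (M i)))

/-- A bipartite pure state is maximally entangled if the reduced state of the party with the
smaller dimension is maximally mixed (a positive multiple of the identity, for states that are not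
normalized). The reduced operators are `M * Mᴴ` and, up to transposition, `Mᴴ * M`. -/
def IsMaximallyEntangled {α β : Type} [Fintype α] [Fintype β] [DecidableEq α] [DecidableEq β]
    (M : Matrix α β ℂ) : Prop :=
  ∃ c : ℝ, 0 < c ∧
    (Fintype.card α ≤ Fintype.card β → M * Mᴴ = (c : ℂ) • (1 : Matrix α α ℂ)) ∧
    (Fintype.card β ≤ Fintype.card α → Mᴴ * M = (c : ℂ) • (1 : Matrix β β ℂ))

/-!  Multipartite systems.  A pure state of `ℂ^(dim 0) ⊗ ⋯ ⊗ ℂ^(dim (n-1))` is given by its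
coefficients in the computational basis `|x⟩`, `x : (p : Fin n) → Fin (dim p)`. -/

/-- The coefficient matrix of a multipartite state with respect to the bipartition `S | Sᶜ` of the
parties: rows are the basis vectors of the parties in `S`, columns those of the other parties. -/
def acrossBipartition {n : ℕ} {dim : Fin n → ℕ} (S : Finset (Fin n))
    (ψ : ((p : Fin n) → Fin (dim p)) → ℂ) :
    Matrix ((p : {p // p ∈ S}) → Fin (dim p)) ((p : {p // p ∉ S}) → Fin (dim p)) ℂ :=
  Matrix.of fun x y =>
    ψ ((Equiv.piEquivPiSubtypeProd (fun p => p ∈ S) (fun p => Fin (dim p))).symm (x, y))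

/-- A family of pairwise orthogonal (nonzero) pure states of a system of `n ≥ 3` parties is
strongly nonlocal if it is not perfectly distinguishable by LOCC in any bipartition. -/
def StronglyNonlocal {ι : Type} [DecidableEq ι] {n : ℕ} {dim : Fin n → ℕ}
    (ψ : ι → ((p : Fin n) → Fin (dim p)) → ℂ) : Prop :=
  3 ≤ n ∧ (∀ i, ψ i ≠ 0) ∧ (∀ i j, i ≠ j → star (ψ i) ⬝ᵥ ψ j = 0) ∧
    ∀ S : Finset (Fin n), S.Nonempty → Sᶜ.Nonempty →
      ¬ LOCCDistinguishable fun i => acrossBipartition S (ψ i)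

/-- The computational basis vector `|x⟩` of three `d`-dimensional systems. -/
noncomputable def ket {d : ℕ} (x : Fin 3 → Fin d) : (Fin 3 → Fin d) → ℂ :=
  Pi.single x 1

/-- The `d + 3` states: `∑ l, ω ^ (j l) |l l l⟩` for `j = 0, …, d - 1`, where `ω = exp (2 π i / d)`,
and, for each of the three parties `p`, the state `∑ l, |l l l⟩` with the entry at the place `p`
replaced by `l + 1` modulo `d`. -/
noncomputable def ghzShiftStates (d : ℕ) : Fin d ⊕ Fin 3 → (Fin 3 → Fin d) → ℂ
  | .inl j => ∑ l : Fin d,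
      Complex.exp (2 * Real.pi * Complex.I / d) ^ ((j : ℕ) * (l : ℕ)) • ket (fun _ => l)
  | .inr p => ∑ l : Fin d, ket (Function.update (fun _ => l) p (finRotate d l))

/-! ### The squared norm of a bipartite state -/

section StateNormSq

variable {α β γ : Type} [Fintype α] [Fintype β] [Fintype γ]

/-! In every bipartition one party `p` stands alone. The `d` phase states and the shift state of `p`
then have the form `A * N i * B` with `N i` a `d × d` unitary and `A`, `Bᵀ` the isometries `|l⟩ ↦
|l, …, l⟩`: they are `d + 1` maximally entangled states of two `d`-level systems, one more than LOCC
can distinguish.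

The bound is `sum_announceWithin_le`. After any sequence of outcomes the states are still `K * N i *
L` with common `K`, `L`. A complete measurement preserves the total of `‖K‖² ‖L‖²` (Frobenius norms)
over its outcomes, and an announcement succeeds for one label only, with weight at most `‖K‖² ‖L‖²`.
So the weights of success sum to at most `‖A‖² ‖B‖² = d²`, whereas perfect discrimination of `d + 1`
states of squared norm `d` would require `(d + 1) d`.

Orthogonality comes from geometric sums of roots of unity and from disjoint supports. -/

theorem stateNormSq_nonneg (M : Matrix α β ℂ) : 0 ≤ stateNormSq M :=
  Finset.sum_nonneg fun _ _ => Finset.sum_nonneg fun _ _ => by positivity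

theorem stateNormSq_transpose (M : Matrix α β ℂ) : stateNormSq Mᵀ = stateNormSq M :=
  Finset.sum_comm

theorem stateNormSq_reindex {α' β' : Type} [Fintype α'] [Fintype β'] (e : α ≃ α') (f : β ≃ β')
    (M : Matrix α β ℂ) : stateNormSq (Matrix.reindex e f M) = stateNormSq M := by
  unfold stateNormSq
  rw [← Equiv.sum_comp e]
  refine Finset.sum_congr rfl fun x _ => ?_
  rw [← Equiv.sum_comp f]
  simp

theorem ofReal_stateNormSq (M : Matrix α β ℂ) :
    (stateNormSq M : ℂ) = (Mᴴ * M).trace := by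
  rw [← stateNormSq_transpose]
  simp only [stateNormSq, Matrix.trace, Matrix.diag, Matrix.mul_apply, Matrix.conjTranspose_apply,
    Matrix.transpose_apply, Complex.ofReal_sum]
  refine Finset.sum_congr rfl fun x _ => Finset.sum_congr rfl fun y _ => ?_
  rw [Complex.star_def, ← Complex.normSq_eq_conj_mul_self, Complex.normSq_eq_norm_sq]

/-- Conservation of total probability in a measurement: insert completeness into `tr (Xᴴ Kᴴ K X)`.
It is applied below both to states and to the accumulated operators. -/
theorem sum_stateNormSq_mul [DecidableEq α] {κ : Type} [Fintype κ] {δ : κ → Type}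
    [∀ k, Fintype (δ k)] (K : (k : κ) → Matrix (δ k) α ℂ) (hK : ∑ k, (K k)ᴴ * K k = 1)
    (X : Matrix α β ℂ) : ∑ k, stateNormSq (K k * X) = stateNormSq X := by
  apply Complex.ofReal_injective
  rw [Complex.ofReal_sum]
  simp only [ofReal_stateNormSq, Matrix.conjTranspose_mul]
  rw [← Matrix.trace_sum]
  have h : ∀ k, Xᴴ * (K k)ᴴ * (K k * X) = Xᴴ * ((K k)ᴴ * K k) * X := fun k => by
    simp only [Matrix.mul_assoc]
  simp only [h]
  rw [← Matrix.sum_mul, ← Matrix.mul_sum, hK, Matrix.mul_one]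

theorem sum_stateNormSq_mul_transpose [DecidableEq β] {κ : Type} [Fintype κ] {δ : κ → Type}
    [∀ k, Fintype (δ k)] (L : (k : κ) → Matrix (δ k) β ℂ) (hL : ∑ k, (L k)ᴴ * L k = 1)
    (X : Matrix α β ℂ) : ∑ k, stateNormSq (X * (L k)ᵀ) = stateNormSq X := by
  rw [← stateNormSq_transpose X, ← sum_stateNormSq_mul L hL]
  refine Finset.sum_congr rfl fun k _ => ?_
  rw [← stateNormSq_transpose, Matrix.transpose_mul, Matrix.transpose_transpose]

theorem stateNormSq_isometry_mul [DecidableEq α] {V : Matrix γ α ℂ} (hV : Vᴴ * V = 1)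
    (X : Matrix α β ℂ) : stateNormSq (V * X) = stateNormSq X := by
  simpa using sum_stateNormSq_mul (κ := Unit) (fun _ => V) (by simpa using hV) X

theorem stateNormSq_mul_isometry_transpose [DecidableEq β] {V : Matrix γ β ℂ} (hV : Vᴴ * V = 1)
    (X : Matrix α β ℂ) : stateNormSq (X * Vᵀ) = stateNormSq X := by
  simpa using sum_stateNormSq_mul_transpose (κ := Unit) (fun _ => V) (by simpa using hV) X

theorem stateNormSq_mul_coisometry [DecidableEq β] {V : Matrix β γ ℂ} (hV : V * Vᴴ = 1)
    (X : Matrix α β ℂ) : stateNormSq (X * V) = stateNormSq X := by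
  refine stateNormSq_mul_isometry_transpose (V := Vᵀ) ?_ X
  rw [show Vᵀᴴ = Vᴴᵀ from rfl, ← Matrix.transpose_mul, hV, Matrix.transpose_one]

/-- Cauchy–Schwarz for each entry of the product. -/
theorem stateNormSq_mul_le (X : Matrix α β ℂ) (Y : Matrix β γ ℂ) :
    stateNormSq (X * Y) ≤ stateNormSq X * stateNormSq Y := by
  rw [← stateNormSq_transpose Y]
  unfold stateNormSq
  rw [Finset.sum_mul_sum]
  refine Finset.sum_le_sum fun x _ => Finset.sum_le_sum fun z _ => ?_
  calc ‖(X * Y) x z‖ ^ 2 ≤ (∑ y, ‖X x y‖ * ‖Y y z‖) ^ 2 := by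
        gcongr
        rw [Matrix.mul_apply]
        exact (norm_sum_le _ _).trans_eq (by simp)
    _ ≤ _ := Finset.sum_mul_sq_le_sq_mul_sq _ _ _

end StateNormSq

/-! ### An upper bound for the success probability of LOCC discrimination -/

/-- For states obtained by local operators from maximally entangled states `N i`, the success
probabilities of an LOCC protocol sum up to at most the product of the squared norms of the local
operators. -/
theorem sum_announceWithin_le {ι : Type} [DecidableEq ι] {Ctrl : ℕ → ℕ → Type}
    (step : {a b : ℕ} → Ctrl a b → LOCCStep ι Ctrl a b) {δ : Type} [Fintype δ] [DecidableEq δ]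
    (N : ι → Matrix δ δ ℂ) (s : Finset ι) (hN : ∀ i ∈ s, N i * (N i)ᴴ = 1) (n : ℕ) :
    ∀ {a b : ℕ} (c : Ctrl a b) (K : Matrix (Fin a) δ ℂ) (L : Matrix δ (Fin b) ℂ),
      ∑ i ∈ s, announceWithin step i n c (K * N i * L) ≤ stateNormSq K * stateNormSq L := by
  -- `K` and `L` stay general, since they absorb the operators of the measurements already made.
  induction n with
  | zero =>
    intro a b c K L
    simpa [announceWithin] using mul_nonneg (stateNormSq_nonneg K) (stateNormSq_nonneg L)
  | succ n ih =>
    intro a b c K L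
    rcases h : step c with j | ⟨r, a', K', hK', next⟩ | ⟨r, b', L', hL', next⟩
    -- Only the announced label contributes; its unitary is absorbed into `K` without changing the
    -- norm.
    · simp only [announceWithin, h]
      rw [Finset.sum_ite_eq]
      split_ifs with hj
      · rw [← stateNormSq_mul_coisometry (hN j hj) K]
        exact stateNormSq_mul_le _ _
      · exact mul_nonneg (stateNormSq_nonneg K) (stateNormSq_nonneg L)
    · simp only [announceWithin, h]
      rw [Finset.sum_comm, ← sum_stateNormSq_mul K' hK' K, Finset.sum_mul]
      refine Finset.sum_le_sum fun k _ => ?_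
      simpa only [Matrix.mul_assoc] using ih (next k) (K' k * K) L
    · simp only [announceWithin, h]
      rw [Finset.sum_comm, ← sum_stateNormSq_mul_transpose L' hL' L, Finset.mul_sum]
      refine Finset.sum_le_sum fun k _ => ?_
      simpa only [Matrix.mul_assoc] using ih (next k) K (L * (L' k)ᵀ)

/-- The bound on the success weights does not depend on the number of rounds, so it survives the
limit. -/
theorem LOCCDistinguishable.sum_stateNormSq_le {ι α β δ : Type} [DecidableEq ι] [Fintype α]
    [Fintype β] [Fintype δ] [DecidableEq δ] {M : ι → Matrix α β ℂ} (hM : LOCCDistinguishable M)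
    (N : ι → Matrix δ δ ℂ) (s : Finset ι) (hN : ∀ i ∈ s, N i * (N i)ᴴ = 1)
    (A : Matrix α δ ℂ) (B : Matrix δ β ℂ) (h : ∀ i ∈ s, M i = A * N i * B) :
    ∑ i ∈ s, stateNormSq (M i) ≤ stateNormSq A * stateNormSq B := by
  obtain ⟨a, b, eA, eB, P, hP⟩ := hM
  refine le_of_tendsto (tendsto_finsetSum s fun i _ => hP i) (Filter.Eventually.of_forall fun n => ?_)
  have key := sum_announceWithin_le P.step N s hN n P.start
    (Matrix.reindex eA (Equiv.refl δ) A) (Matrix.reindex (Equiv.refl δ) eB B)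
  rw [stateNormSq_reindex, stateNormSq_reindex] at key
  refine le_trans (le_of_eq (Finset.sum_congr rfl fun i hi => ?_)) key
  congr 1
  rw [h i hi]
  ext x y
  simp [Matrix.mul_apply]

/-! ### Matrices of maps between computational bases -/

section BasisMap

variable {α β γ : Type} [DecidableEq α] [DecidableEq β]

/-- The matrix that sends the basis vector `|l⟩` to `|g l⟩`. -/
def basisMap (g : γ → α) : Matrix α γ ℂ :=
  Matrix.of fun x l => if g l = x then 1 else 0

theorem basisMap_comp [Fintype β] (g : β → α) (h : γ → β) :
    basisMap (g ∘ h) = basisMap g * basisMap h := by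
  ext x l
  simp [basisMap, Matrix.mul_apply]

theorem conjTranspose_basisMap_mul_self [DecidableEq γ] [Fintype α] {g : γ → α} (hg : Function.Injective g) :
    (basisMap g)ᴴ * basisMap g = 1 := by
  ext l m
  simp [basisMap, Matrix.mul_apply, Matrix.one_apply, apply_ite, hg.eq_iff, eq_comm]

theorem basisMap_mul_conjTranspose_self [Fintype γ] {g : γ → α} (hg : Function.Bijective g) :
    basisMap g * (basisMap g)ᴴ = 1 := by
  ext x y
  obtain ⟨l, rfl⟩ := hg.2 x
  rw [Matrix.mul_apply, Finset.sum_eq_single l]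
  · simp [basisMap, Matrix.one_apply]
  · intro m _ hm
    simp [basisMap, hg.1.ne hm]
  · simp

theorem stateNormSq_basisMap [Fintype α] [Fintype γ] (g : γ → α) :
    stateNormSq (basisMap g) = Fintype.card γ := by
  rw [← stateNormSq_transpose]
  simp [stateNormSq, basisMap, apply_ite]

/-- The coefficient matrix of the state `∑ l, c l |g l⟩|h l⟩`. -/
def schmidtMatrix [Fintype γ] [DecidableEq γ] (c : γ → ℂ) (g : γ → α) (h : γ → β) : Matrix α β ℂ :=
  basisMap g * Matrix.diagonal c * (basisMap h)ᵀ

theorem schmidtMatrix_apply [Fintype γ] [DecidableEq γ] (c : γ → ℂ) (g : γ → α) (h : γ → β) (x : α) (y : β) :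
    schmidtMatrix c g h x y = ∑ l, if g l = x ∧ h l = y then c l else 0 := by
  rw [schmidtMatrix, Matrix.mul_apply]
  simp only [Matrix.mul_diagonal, basisMap, Matrix.of_apply, Matrix.transpose_apply]
  refine Finset.sum_congr rfl fun l _ => ?_
  by_cases h1 : g l = x <;> by_cases h2 : h l = y <;> simp [h1, h2]

theorem schmidtMatrix_transpose [Fintype γ] [DecidableEq γ] (c : γ → ℂ) (g : γ → α) (h : γ → β) :
    (schmidtMatrix c g h)ᵀ = schmidtMatrix c h g := by
  ext x y
  simp [schmidtMatrix_apply, and_comm]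

theorem diagonal_mul_conjTranspose_of_norm_one [Fintype γ] [DecidableEq γ] {c : γ → ℂ} (hc : ∀ l, ‖c l‖ = 1) :
    Matrix.diagonal c * (Matrix.diagonal c)ᴴ = 1 := by
  rw [Matrix.diagonal_conjTranspose, Matrix.diagonal_mul_diagonal, ← Matrix.diagonal_one]
  congr 1
  funext l
  simp [Complex.mul_conj, Complex.normSq_eq_norm_sq, hc l]

theorem schmidtMatrix_mul_conjTranspose [Fintype β] [Fintype γ] [DecidableEq γ] {c : γ → ℂ}
    (hc : ∀ l, ‖c l‖ = 1) {g : γ → α} (hg : Function.Bijective g) {h : γ → β}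
    (hh : Function.Injective h) : schmidtMatrix c g h * (schmidtMatrix c g h)ᴴ = 1 := by
  have hB : (basisMap h)ᵀ * (basisMap h)ᵀᴴ = 1 := by
    rw [show (basisMap h)ᵀᴴ = (basisMap h)ᴴᵀ from rfl, ← Matrix.transpose_mul,
      conjTranspose_basisMap_mul_self hh, Matrix.transpose_one]
  calc _ = basisMap g * (Matrix.diagonal c * ((basisMap h)ᵀ * (basisMap h)ᵀᴴ)
        * (Matrix.diagonal c)ᴴ) * (basisMap g)ᴴ := by
        simp only [schmidtMatrix, Matrix.conjTranspose_mul, Matrix.mul_assoc]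
    _ = 1 := by
        rw [hB, Matrix.mul_one, diagonal_mul_conjTranspose_of_norm_one hc, Matrix.mul_one,
          basisMap_mul_conjTranspose_self hg]

theorem conjTranspose_mul_schmidtMatrix [Fintype α] [Fintype γ] [DecidableEq γ] {c : γ → ℂ}
    (hc : ∀ l, ‖c l‖ = 1) {g : γ → α} (hg : Function.Injective g) {h : γ → β}
    (hh : Function.Bijective h) : (schmidtMatrix c g h)ᴴ * schmidtMatrix c g h = 1 := by
  have key := schmidtMatrix_mul_conjTranspose hc hh hg
  rw [← schmidtMatrix_transpose c g h,
    show (schmidtMatrix c g h)ᵀᴴ = (schmidtMatrix c g h)ᴴᵀ from rfl,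
    ← Matrix.transpose_mul] at key
  rw [← Matrix.transpose_transpose ((schmidtMatrix c g h)ᴴ * _), key, Matrix.transpose_one]

theorem stateNormSq_schmidtMatrix [Fintype α] [Fintype β] [Fintype γ] [DecidableEq γ] {c : γ → ℂ}
    (hc : ∀ l, ‖c l‖ = 1) {g : γ → α} (hg : Function.Injective g) {h : γ → β}
    (hh : Function.Injective h) : stateNormSq (schmidtMatrix c g h) = Fintype.card γ := by
  rw [schmidtMatrix, stateNormSq_mul_isometry_transpose (conjTranspose_basisMap_mul_self hh),
    stateNormSq_isometry_mul (conjTranspose_basisMap_mul_self hg)]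
  simp [stateNormSq, Matrix.diagonal_apply, apply_ite, hc]

/-- Separates a small core matrix from the embeddings, giving the form `A * N i * B` that the LOCC
bound needs. -/
theorem schmidtMatrix_comp {δ : Type} [Fintype γ] [DecidableEq γ] [Fintype δ] [DecidableEq δ] (c : γ → ℂ)
    (g : δ → α) (g' : γ → δ) (h : δ → β) (h' : γ → δ) :
    schmidtMatrix c (g ∘ g') (h ∘ h') =
      basisMap g * schmidtMatrix c g' h' * (basisMap h)ᵀ := by
  simp only [schmidtMatrix, basisMap_comp, Matrix.transpose_mul, Matrix.mul_assoc]

end BasisMap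

/-! ### The states -/

/-- The phases of the states. -/
noncomputable def ghzPhase (d : ℕ) : Fin d ⊕ Fin 3 → Fin d → ℂ
  | .inl j, l => Complex.exp (2 * Real.pi * Complex.I / d) ^ ((j : ℕ) * (l : ℕ))
  | .inr _, _ => 1

/-- The permutation of the levels of the party `p` in the state `i`. -/
def ghzPerm (d : ℕ) : Fin d ⊕ Fin 3 → Fin 3 → Equiv.Perm (Fin d)
  | .inl _, _ => 1
  | .inr q, p => if p = q then finRotate d else 1

theorem ghzShiftStates_apply {d : ℕ} (i : Fin d ⊕ Fin 3) (x : Fin 3 → Fin d) :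
    ghzShiftStates d i x =
      ∑ l, if (fun p => ghzPerm d i p l) = x then ghzPhase d i l else 0 := by
  rcases i with j | q
  · simp [ghzShiftStates, ghzPerm, ghzPhase, ket, Pi.single_apply, eq_comm]
  · have h : ∀ l : Fin d, Function.update (fun _ => l) q (finRotate d l) =
        fun p => ghzPerm d (.inr q) p l := fun l => by
      funext p
      by_cases hp : p = q <;> simp [ghzPerm, hp]
    simp only [ghzShiftStates, h, ghzPhase, ket, Finset.sum_apply, Pi.single_apply, eq_comm]

theorem norm_ghzPhase {d : ℕ} (i : Fin d ⊕ Fin 3) (l : Fin d) : ‖ghzPhase d i l‖ = 1 := by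
  rcases i with j | q
  · have h : (2 * Real.pi * Complex.I / d : ℂ) = ((2 * Real.pi / d : ℝ) : ℂ) * Complex.I := by
      push_cast
      ring
    simp only [ghzPhase, norm_pow]
    rw [h, Complex.norm_exp_ofReal_mul_I, one_pow]
  · simp [ghzPhase]

/-- The basis vector of the parties satisfying `P` that appears in the `l`-th term of the
state `i`. -/
def ghzBranch (d : ℕ) (i : Fin d ⊕ Fin 3) (P : Fin 3 → Prop) (l : Fin d) : {p // P p} → Fin d :=
  fun p => ghzPerm d i p l

theorem ghzBranch_injective {d : ℕ} (i : Fin d ⊕ Fin 3) {P : Fin 3 → Prop} (hP : ∃ p, P p) :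
    Function.Injective (ghzBranch d i P) := by
  obtain ⟨p, hp⟩ := hP
  exact fun l m h => (ghzPerm d i p).injective (congrFun h ⟨p, hp⟩)

theorem ghzBranch_bijective {d : ℕ} (i : Fin d ⊕ Fin 3) {P : Fin 3 → Prop}
    [Fintype {p // P p}] (hP : Fintype.card {p // P p} = 1) :
    Function.Bijective (ghzBranch d i P) := by
  classical
  rw [Fintype.bijective_iff_injective_and_card]
  refine ⟨ghzBranch_injective i ?_, by simp [hP]⟩
  obtain ⟨⟨p, hp⟩, -⟩ := Fintype.card_eq_one_iff.1 hP
  exact ⟨p, hp⟩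

theorem acrossBipartition_ghzShiftStates {d : ℕ} (i : Fin d ⊕ Fin 3) (S : Finset (Fin 3)) :
    acrossBipartition (dim := fun _ => d) S (ghzShiftStates d i) =
      schmidtMatrix (ghzPhase d i) (ghzBranch d i (· ∈ S)) (ghzBranch d i (· ∉ S)) := by
  ext x y
  rw [schmidtMatrix_apply]
  simp only [acrossBipartition, Matrix.of_apply, ghzShiftStates_apply]
  refine Finset.sum_congr rfl fun l _ => ?_
  congr 1
  rw [Equiv.eq_symm_apply, Prod.ext_iff]
  rfl

theorem exists_eq_singleton_or_compl_eq_singleton (S : Finset (Fin 3)) (hS : S.Nonempty)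
    (hS' : Sᶜ.Nonempty) : ∃ p, S = {p} ∨ Sᶜ = {p} := by
  revert S
  decide

/-! ### Maximal entanglement -/

theorem isMaximallyEntangled_ghzShiftStates {d : ℕ} (hd : 3 ≤ d) (i : Fin d ⊕ Fin 3)
    (S : Finset (Fin 3)) (hS : S.Nonempty) (hS' : Sᶜ.Nonempty) :
    IsMaximallyEntangled (acrossBipartition (dim := fun _ => d) S (ghzShiftStates d i)) := by
  have hcard : Fintype.card {p // p ∈ S} + Fintype.card {p // p ∉ S} = 3 := by
    rw [Fintype.card_subtype_compl]
    exact Nat.add_sub_cancel' (Fintype.card_subtype_le (· ∈ S))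
  obtain ⟨p, hp⟩ := hS
  obtain ⟨q, hq⟩ := hS'
  rw [Finset.mem_compl] at hq
  have h1 : 0 < Fintype.card {p // p ∈ S} := Fintype.card_pos_iff.2 ⟨⟨p, hp⟩⟩
  have h2 : 0 < Fintype.card {p // p ∉ S} := Fintype.card_pos_iff.2 ⟨⟨q, hq⟩⟩
  have hS : Fintype.card ({p // p ∈ S} → Fin d) = d ^ Fintype.card {p // p ∈ S} := by simp
  have hS' : Fintype.card ({p // p ∉ S} → Fin d) = d ^ Fintype.card {p // p ∉ S} := by simp
  have hd' : 1 < d := by omega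
  rw [acrossBipartition_ghzShiftStates]
  refine ⟨1, one_pos, fun h => ?_, fun h => ?_⟩
  · rw [Complex.ofReal_one, one_smul]
    -- Three parties in all: the side of smaller dimension is a single party, on which the branches
    -- run through the whole basis.
    rw [hS, hS', Nat.pow_le_pow_iff_right hd'] at h
    have hc : Fintype.card {p // p ∈ S} = 1 := by omega
    exact schmidtMatrix_mul_conjTranspose (norm_ghzPhase i)
      (ghzBranch_bijective i hc) (ghzBranch_injective i ⟨q, hq⟩)
  · rw [Complex.ofReal_one, one_smul]
    rw [hS, hS', Nat.pow_le_pow_iff_right hd'] at h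
    have hc : Fintype.card {p // p ∉ S} = 1 := by omega
    exact conjTranspose_mul_schmidtMatrix (norm_ghzPhase i) (ghzBranch_injective i ⟨p, hp⟩)
      (ghzBranch_bijective i hc)

theorem stateNormSq_acrossBipartition_ghzShiftStates {d : ℕ} (i : Fin d ⊕ Fin 3)
    (S : Finset (Fin 3)) (hS : S.Nonempty) (hS' : Sᶜ.Nonempty) :
    stateNormSq (acrossBipartition (dim := fun _ => d) S (ghzShiftStates d i)) = d := by
  rw [acrossBipartition_ghzShiftStates, stateNormSq_schmidtMatrix (norm_ghzPhase i)
    (ghzBranch_injective i hS)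
    (ghzBranch_injective i (hS'.imp fun _ => Finset.mem_compl.1)), Fintype.card_fin]

/-! ### Nonvanishing and orthogonality -/

theorem ghzShiftStates_ne_zero {d : ℕ} (hd : 3 ≤ d) (i : Fin d ⊕ Fin 3) :
    ghzShiftStates d i ≠ 0 := by
  intro h
  have key := stateNormSq_acrossBipartition_ghzShiftStates i {0} (by simp) ⟨1, by simp⟩
  rw [h] at key
  have hpos : (0 : ℝ) < d := by exact_mod_cast (by omega : 0 < d)
  simp [stateNormSq, acrossBipartition] at key
  linarith

theorem finRotate_apply_ne {d : ℕ} (hd : 3 ≤ d) (l : Fin d) : finRotate d l ≠ l := by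
  obtain ⟨n, rfl⟩ : ∃ n, d = n + 2 := ⟨d - 2, by omega⟩
  simp

theorem star_dotProduct_ghzShiftStates {d : ℕ} (i i' : Fin d ⊕ Fin 3) :
    star (ghzShiftStates d i) ⬝ᵥ ghzShiftStates d i' =
      ∑ l, ∑ m, if (fun p => ghzPerm d i p l) = fun p => ghzPerm d i' p m
        then star (ghzPhase d i l) * ghzPhase d i' m else 0 := by
  simp only [dotProduct, Pi.star_apply, ghzShiftStates_apply, star_sum, Finset.sum_mul_sum]
  rw [Finset.sum_comm]
  refine Finset.sum_congr rfl fun l _ => ?_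
  rw [Finset.sum_comm]
  refine Finset.sum_congr rfl fun m _ => ?_
  have h : ∀ x, star (if (fun p => ghzPerm d i p l) = x then ghzPhase d i l else 0) *
      (if (fun p => ghzPerm d i' p m) = x then ghzPhase d i' m else 0) =
      if (fun p => ghzPerm d i' p m) = x then (if (fun p => ghzPerm d i p l) = x
        then star (ghzPhase d i l) * ghzPhase d i' m else 0) else 0 := fun x => by
    split_ifs <;> simp
  simp only [h, Finset.sum_ite_eq, Finset.mem_univ, if_true]

/-- Disjoint supports: a party `r ≠ q` shifted in neither state forces `l = m`, while party `q`,
shifted only in the second, forces `l = finRotate d m`; but the rotation has no fixed point. -/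
theorem ghzPerm_ne {d : ℕ} (hd : 3 ≤ d) (q : Fin 3) {i : Fin d ⊕ Fin 3} (hi : i ≠ .inr q)
    (l m : Fin d) : (fun p => ghzPerm d i p l) ≠ fun p => ghzPerm d (.inr q) p m := by
  intro h
  obtain ⟨r, hrq, hr⟩ : ∃ r, r ≠ q ∧ ghzPerm d i r = 1 := by
    rcases i with j | q'
    · obtain ⟨r, hr⟩ := exists_ne q
      exact ⟨r, hr, rfl⟩
    · obtain ⟨r, hr, hr'⟩ : ∃ r : Fin 3, r ≠ q ∧ r ≠ q' := by
        clear h hi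
        revert q q'
        decide
      exact ⟨r, hr, by simp [ghzPerm, hr']⟩
  have hq : ghzPerm d i q = 1 := by
    rcases i with j | q'
    · rfl
    · have : q ≠ q' := fun e => hi (by rw [e])
      simp [ghzPerm, this]
  have h1 := congrFun h r
  have h2 := congrFun h q
  simp only [hr, hq, Equiv.Perm.one_apply] at h1 h2
  simp only [ghzPerm, hrq, if_true, if_false, Equiv.Perm.one_apply] at h1 h2
  exact finRotate_apply_ne hd m (by rw [← h2, h1])

/-- A geometric sum with ratio `ω ^ (k - j)`, a `d`-th root of unity other than `1`. -/
theorem sum_star_ghzPhase_mul {d : ℕ} {j k : Fin d} (hjk : j ≠ k) :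
    ∑ l, star (ghzPhase d (.inl j) l) * ghzPhase d (.inl k) l = 0 := by
  have hd : d ≠ 0 := fun h => (h ▸ j).elim0
  have hω := Complex.isPrimitiveRoot_exp d hd
  set ω := Complex.exp (2 * Real.pi * Complex.I / d) with hωdef
  have hstar : star ω = ω⁻¹ := by
    rw [Complex.star_def]
    exact (Complex.inv_eq_conj (hω.norm'_eq_one hd)).symm
  have hω0 : ω ≠ 0 := Complex.exp_ne_zero _
  set z : ℂ := (ω ^ (j : ℕ))⁻¹ * ω ^ (k : ℕ) with hz
  have hterm : ∀ l : Fin d,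
      star (ghzPhase d (.inl j) l) * ghzPhase d (.inl k) l = z ^ (l : ℕ) := fun l => by
    simp only [ghzPhase, ← hωdef, star_pow, hstar, hz, mul_pow, pow_mul, inv_pow]
  have hz1 : z ≠ 1 := fun h => by
    rw [hz, inv_mul_eq_one₀ (pow_ne_zero _ hω0)] at h
    exact hjk (Fin.ext (hω.pow_inj j.2 k.2 h))
  have hzd : z ^ d = 1 := by
    rw [hz, mul_pow, inv_pow, ← pow_mul, ← pow_mul, mul_comm (j : ℕ), mul_comm (k : ℕ), pow_mul, pow_mul,
      hω.pow_eq_one]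
    simp
  simp only [hterm]
  rw [Fin.sum_univ_eq_sum_range (fun l => z ^ l), geom_sum_eq hz1, hzd]
  simp

theorem ghzShiftStates_orthogonal {d : ℕ} (hd : 3 ≤ d) (i i' : Fin d ⊕ Fin 3) (h : i ≠ i') :
    star (ghzShiftStates d i) ⬝ᵥ ghzShiftStates d i' = 0 := by
  rw [star_dotProduct_ghzShiftStates]
  rcases i' with k | q
  · rcases i with j | q
    · have hjk : j ≠ k := fun e => h (by rw [e])
      have he : ∀ l m : Fin d, ((fun p => ghzPerm d (.inl j) p l) =
          fun p => ghzPerm d (.inl k) p m) ↔ l = m := fun l m =>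
        ⟨fun e => congrFun e 0, fun e => by rw [e]; rfl⟩
      simpa [he] using sum_star_ghzPhase_mul hjk
    · refine Finset.sum_eq_zero fun l _ => Finset.sum_eq_zero fun m _ => if_neg ?_
      exact (ghzPerm_ne hd q h.symm m l).symm
  · exact Finset.sum_eq_zero fun l _ => Finset.sum_eq_zero fun m _ => if_neg (ghzPerm_ne hd q h l m)

/-! ### Indistinguishability across each bipartition -/

/-- If the permutations in the state `i` are the same for all parties on the same side of the
bipartition, the state is a maximally entangled state of two `d`-dimensional systems, embedded
by `|l⟩ ↦ |l, …, l⟩` on both sides. -/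
theorem acrossBipartition_ghzShiftStates_of_forall {d : ℕ} (i : Fin d ⊕ Fin 3)
    (S : Finset (Fin 3)) (g h : Equiv.Perm (Fin d)) (hg : ∀ p ∈ S, ghzPerm d i p = g)
    (hh : ∀ p ∉ S, ghzPerm d i p = h) :
    acrossBipartition (dim := fun _ => d) S (ghzShiftStates d i) =
      basisMap (α := {p // p ∈ S} → Fin d) (fun l _ => l) * schmidtMatrix (ghzPhase d i) g h *
        (basisMap (α := {p // p ∉ S} → Fin d) fun l _ => l)ᵀ := by
  rw [acrossBipartition_ghzShiftStates, ← schmidtMatrix_comp]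
  congr 1
  · funext l p
    simp [ghzBranch, hg p p.2]
  · funext l p
    simp [ghzBranch, hh p p.2]

/-- The condition on `i` admits the phase states and the shift of the lone party `p`. A shift of one
of the two grouped parties would act differently on members of the same side. -/
theorem exists_ghzPerm_eq {d : ℕ} (S : Finset (Fin 3)) {p : Fin 3} (hp : S = {p} ∨ Sᶜ = {p})
    {i : Fin d ⊕ Fin 3} (hi : ∀ q, i = .inr q → q = p) :
    ∃ g h : Equiv.Perm (Fin d), (∀ q ∈ S, ghzPerm d i q = g) ∧ ∀ q ∉ S, ghzPerm d i q = h := by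
  rcases i with j | q
  · exact ⟨1, 1, fun _ _ => rfl, fun _ _ => rfl⟩
  · obtain rfl := hi q rfl
    rcases hp with rfl | hp
    · exact ⟨finRotate d, 1, fun r hr => if_pos (by simpa using hr),
        fun r hr => if_neg (by simpa using hr)⟩
    · have hmem : ∀ r, r ∉ S ↔ r = q := fun r => by
        rw [← Finset.mem_compl, hp, Finset.mem_singleton]
      exact ⟨1, finRotate d, fun r hr => if_neg fun e => (hmem r).2 e hr,
        fun r hr => if_pos ((hmem r).1 hr)⟩

theorem not_LOCCDistinguishable_ghzShiftStates {d : ℕ} (hd : 3 ≤ d) (S : Finset (Fin 3))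
    (hS : S.Nonempty) (hS' : Sᶜ.Nonempty) :
    ¬ LOCCDistinguishable fun i =>
      acrossBipartition (dim := fun _ => d) S (ghzShiftStates d i) := by
  intro hM
  obtain ⟨p, hp⟩ := exists_eq_singleton_or_compl_eq_singleton S hS hS'
  -- All phase states and the shift of `p`: already these `d + 1` states cannot be distinguished.
  let s : Finset (Fin d ⊕ Fin 3) := Finset.univ.disjSum {p}
  have hs : ∀ i ∈ s, ∃ g h : Equiv.Perm (Fin d),
      (∀ q ∈ S, ghzPerm d i q = g) ∧ ∀ q ∉ S, ghzPerm d i q = h := fun i hi =>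
    exists_ghzPerm_eq S hp fun q hq => by
      subst hq
      simpa [s] using hi
  choose! g h hg hh using hs
  have key := hM.sum_stateNormSq_le (fun i => schmidtMatrix (ghzPhase d i) (g i) (h i)) s
    (fun i _ => schmidtMatrix_mul_conjTranspose (norm_ghzPhase i) (g i).bijective
      (h i).injective) (basisMap fun l _ => l) (basisMap fun l _ => l)ᵀ
    fun i hi => acrossBipartition_ghzShiftStates_of_forall i S (g i) (h i) (hg i hi) (hh i hi)
  simp only [stateNormSq_acrossBipartition_ghzShiftStates _ S hS hS', stateNormSq_transpose,
    stateNormSq_basisMap, Fintype.card_fin, Finset.sum_const, nsmul_eq_mul] at key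
  have hcard : s.card = d + 1 := by simp [s]
  have hpos : (0 : ℝ) < d := by exact_mod_cast (by omega : 0 < d)
  rw [hcard] at key
  push_cast at key
  -- Here `key` reads `(d + 1) * d ≤ d * d`.
  nlinarith

theorem theorem3 (d : ℕ) (hd : 3 ≤ d) :
    (∀ (i : Fin d ⊕ Fin 3) (S : Finset (Fin 3)), S.Nonempty → Sᶜ.Nonempty →
      IsMaximallyEntangled (acrossBipartition (dim := fun _ => d) S (ghzShiftStates d i))) ∧
    StronglyNonlocal (dim := fun _ : Fin 3 => d) (ghzShiftStates d) :=
  ⟨isMaximallyEntangled_ghzShiftStates hd, le_rfl, ghzShiftStates_ne_zero hd,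
    ghzShiftStates_orthogonal hd, not_LOCCDistinguishable_ghzShiftStates hd⟩
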